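/- Let $[2]^*$ be the set of all finite words over the alphabet $\{1,2\}$, partially ordered by $u\le w$ if and only if $w$ has a subword $w(i_1)w(i_2)\cdots w(i_l)$ with $i_1<\dots<i_l$, $l=\ell(u)$, and $u(j)\le w(i_j)$ for $1\le j\le l$. Here $\ell(w)$ denotes the length of $w$. Let $\zeta$ be the zeta function of this poset and let $\zeta^m$ be its $m$-th power in the incidence algebra ($\zeta^0$ is the identity). Let $f$ be the continuous algebra endomorphism of the ring of formal power series $\mathbb{Q}[[x,y]]$ with $$f(x)=x+y,\qquad f(y)=\frac{y}{1-x},$$ and let $a_m(t),b_m(t)\in\mathbb{Q}[[t]]$ be obtained from $f^m(x)$ and $f^m(y)$ ($f^m$ being the $m$-fold iterate) by setting $x=y=t$. For all integers $m\ge 0$ define $\bar a_m(t)=\sum_{i\ge0}(-1)^i\alpha_{m,i}t^i$ and $d_m(t)=\sum_{i\ge0}(-1)^i\delta_{m,i}t^i$, where $$\alpha_{m,i}=\begin{cases}\dfrac{(m+1)2^i}{2i+1}\dbinom{\frac{m+2i}{2}}{\frac{m-2i}{2}} & m\text{ even},\\[2ex] 2^{i+1}\dbinom{\frac{m+2i+1}{2}}{\frac{m-2i-1}{2}}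 & m\text{ odd},\end{cases}\qquad \delta_{m,i}=\begin{cases}\dfrac{m2^i}{m+2i}\dbinom{\frac{m+2i}{2}}{\frac{m-2i}{2}} & m\text{ even},\\[2ex] 2^{i}\dbinom{\frac{m+2i-1}{2}}{\frac{m-2i-1}{2}} & m\text{ odd}.\end{cases}$$ Here $\binom{p}{q}=0$ for $q<0$ or $q>p$, except that $\binom{p}{0}=1$ for every $p$; and for $m=i=0$ the quotient $\frac{m2^i}{m+2i}$ is read as $1$, so that $\delta_{0,0}=1$. **Theorem.** For every $m\ge0$ the series $1-a_m(t)-b_m(t)$ and $d_m(t)$ have constant term $1$. Let $u\in[2]^*$ contain $l_1$ ones and $l_2$ twos. Then, for every $m\ge0$, $$\sum_{w\in[2]^*}\zeta^m(u,w)\,t^{\ell(w)}=a_m(t)^{l_1}\,b_m(t)^{l_2}\prod_{i=0}^{m-1}\frac{1}{1-a_i(t)-b_i(t)}.$$ Furthermore, for every $m\ge 0$, $$a_m(t)=\frac{t\,\bar a_m(t)}{d_m(t)}\qquad\text{and}\qquad b_m(t)=\frac{t}{d_m(t)\,d_{m+1}(t)}.$$ -/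

import Mathlib

open Finset

/-- The alphabet `[n] = {1, 2, …, n}`. -/
abbrev Letter (n : ℕ) : Type := {k : ℕ // 1 ≤ k ∧ k ≤ n}

instance instFiniteLetter (n : ℕ) : Finite (Letter n) :=
  Set.Finite.to_subtype ((Set.finite_Iic n).subset fun _ hk => hk.2)

noncomputable instance instFintypeLetter (n : ℕ) : Fintype (Letter n) :=
  Fintype.ofFinite _

/-- The set `[n]^*` of all finite words over `[n]` (compositions with all parts at most `n`). -/
@[ext]
structure Word (n : ℕ) where
  letters : List (Letter n)

namespace Word

variable {n : ℕ}

/-- The length `ℓ(w)`. -/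
def length (w : Word n) : ℕ := w.letters.length

/-- The entry `l_k` of the type `t(w) = (l_1, …, l_n)`: the number of `k`'s in `w`. -/
def mult (w : Word n) (k : Letter n) : ℕ := w.letters.count k

/-- Composition order: `u ≤ w` if and only if `w` has a subword `v` of length `ℓ(u)` such that
`u(j) ≤ v(j)` for all `j`. -/
instance instLE : LE (Word n) where
  le u w := ∃ v : List (Letter n), v.Sublist w.letters ∧
    List.Forall₂ (fun a b : Letter n => a.1 ≤ b.1) u.letters v

theorem le_iff_sublistForall (u w : Word n) :
    u ≤ w ↔ List.SublistForall₂ (fun a b : Letter n => a ≤ b) u.letters w.letters := by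
  rw [List.sublistForall₂_iff]
  exact ⟨fun ⟨v, h1, h2⟩ => ⟨v, h2, h1⟩, fun ⟨v, h2, h1⟩ => ⟨v, h1, h2⟩⟩

theorem length_le_of_le {u w : Word n} (h : u ≤ w) : u.length ≤ w.length := by
  obtain ⟨v, h1, h2⟩ := h
  exact h2.length_eq.trans_le h1.length_le

theorem eq_of_forall_le {l l' : List (Letter n)}
    (h : List.Forall₂ (fun a b : Letter n => a.1 ≤ b.1) l l')
    (h' : List.Forall₂ (fun a b : Letter n => a.1 ≤ b.1) l' l) : l = l' := by
  induction h with
  | nil => rfl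
  | cons hab _ ih =>
    cases h' with
    | cons hba ht => rw [ih ht, Subtype.ext (le_antisymm hab hba)]

instance instPartialOrder : PartialOrder (Word n) where
  le_refl u := (le_iff_sublistForall u u).2 (List.SublistForall₂.is_refl.refl _)
  le_trans u v w h1 h2 := (le_iff_sublistForall u w).2
    (List.SublistForall₂.is_trans.trans _ _ _
      ((le_iff_sublistForall u v).1 h1) ((le_iff_sublistForall v w).1 h2))
  le_antisymm u w h1 h2 := by
    have hl : u.length = w.length := le_antisymm (length_le_of_le h1) (length_le_of_le h2)
    obtain ⟨v, s1, f1⟩ := h1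
    obtain ⟨v', s2, f2⟩ := h2
    have e1 : v = w.letters := s1.eq_of_length (f1.length_eq.symm.trans hl)
    have e2 : v' = u.letters := s2.eq_of_length (f2.length_eq.symm.trans hl.symm)
    subst e1 e2
    exact Word.ext (eq_of_forall_le f1 f2)

theorem letters_injective : Function.Injective (letters : Word n → List (Letter n)) :=
  fun _ _ h => Word.ext h

theorem finite_length_eq (n N : ℕ) : {w : Word n | w.length = N}.Finite :=
  (List.finite_length_eq (Letter n) N).preimage letters_injective.injOn

theorem finite_length_le (n N : ℕ) : {w : Word n | w.length ≤ N}.Finite :=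
  (List.finite_length_le (Letter n) N).preimage letters_injective.injOn

noncomputable instance instLocallyFiniteOrder : LocallyFiniteOrder (Word n) :=
  LocallyFiniteOrder.ofFiniteIcc fun _ b =>
    (finite_length_le n b.length).subset fun _ hw => length_le_of_le hw.2

noncomputable instance instDecidableEq : DecidableEq (Word n) := Classical.decEq _

noncomputable instance instDecidableLE : DecidableLE (Word n) := Classical.decRel _

/-- The finite set of words of length `N` over `[n]`. -/
noncomputable def ofLength (n N : ℕ) : Finset (Word n) := (finite_length_eq n N).toFinset

theorem mem_ofLength {N : ℕ} {w : Word n} : w ∈ ofLength n N ↔ w.length = N := by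
  simp [ofLength]

end Word

/-- `ζ^m`, the `m`-th convolution power of the zeta function in the incidence algebra
of `[n]^*`. -/
noncomputable def zetaPow (n m : ℕ) : IncidenceAlgebra ℤ (Word n) :=
  (IncidenceAlgebra.zeta ℤ) ^ m

/-- The length generating function `∑_w ζ^m(u, w) t^{ℓ(w)}`: the coefficient of `t^N` is the
finite sum of `ζ^m(u, w)` over the words `w ∈ [n]^*` of length `N`. -/
noncomputable def zetaPowLengthSeries (n m : ℕ) (u : Word n) : PowerSeries ℚ :=
  PowerSeries.mk fun N => ((∑ w ∈ Word.ofLength n N, zetaPow n m u w : ℤ) : ℚ)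

/-- The series `(x_k + ⋯ + x_n) / (1 - x_1 - ⋯ - x_{k-1})`. The denominator has constant
term `1`. -/
noncomputable def substImage (n : ℕ) (k : Letter n) : MvPowerSeries (Letter n) ℚ :=
  (∑ j : Letter n with k.1 ≤ j.1, MvPowerSeries.X j) *
    (1 - ∑ j : Letter n with j.1 < k.1, MvPowerSeries.X j)⁻¹

theorem hasSubst_substImage (n : ℕ) : MvPowerSeries.HasSubst (substImage n) :=
  MvPowerSeries.hasSubst_of_constantCoeff_zero fun k => by simp [substImage]

/-- The continuous algebra endomorphism `f` of the formal power series ring in commuting variables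
`x_1, …, x_n` with `f(x_k) = (x_k + ⋯ + x_n) / (1 - x_1 - ⋯ - x_{k-1})`. -/
noncomputable def substMap (n : ℕ) (p : MvPowerSeries (Letter n) ℚ) :
    MvPowerSeries (Letter n) ℚ :=
  MvPowerSeries.subst (substImage n) p

/-- The length specialization `x_1 = ⋯ = x_n = t`. -/
noncomputable def lengthSpec (n : ℕ) (p : MvPowerSeries (Letter n) ℚ) : PowerSeries ℚ :=
  MvPowerSeries.subst (fun _ : Letter n => (PowerSeries.X : PowerSeries ℚ)) p

theorem hasSubst_lengthSpec (n : ℕ) :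
    MvPowerSeries.HasSubst (fun _ : Letter n => (PowerSeries.X : PowerSeries ℚ)) :=
  MvPowerSeries.hasSubst_of_constantCoeff_zero fun _ => PowerSeries.constantCoeff_X

/-- The letter `1` of `[2]`. -/
def letterOne : Letter 2 := ⟨1, le_refl 1, one_le_two⟩

/-- The letter `2` of `[2]`. -/
def letterTwo : Letter 2 := ⟨2, one_le_two, le_refl 2⟩

/-- `a_m(t)`: the iterate `f^m(x)` for `n = 2`, specialized at `x = y = t`. -/
noncomputable def aSeries (m : ℕ) : PowerSeries ℚ :=
  lengthSpec 2 ((substMap 2)^[m] (MvPowerSeries.X letterOne))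

/-- `b_m(t)`: the iterate `f^m(y)` for `n = 2`, specialized at `x = y = t`. -/
noncomputable def bSeries (m : ℕ) : PowerSeries ℚ :=
  lengthSpec 2 ((substMap 2)^[m] (MvPowerSeries.X letterTwo))

/-- The binomial coefficient `p choose q` of integers, with the convention that it is `0` for
`q < 0` or `q > p`, except that it is `1` for `q = 0` and any `p`. -/
def binom (p q : ℤ) : ℚ := if 0 ≤ q then (Nat.choose p.toNat q.toNat : ℚ) else 0

/-- The coefficients `α_{m,i}`. The divisions by `2` inside the binomials are exact. -/
def alphaCoeff (m i : ℕ) : ℚ :=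
  if Even m then
    ((m : ℚ) + 1) * 2 ^ i / (2 * (i : ℚ) + 1) *
      binom (((m : ℤ) + 2 * i) / 2) (((m : ℤ) - 2 * i) / 2)
  else
    2 ^ (i + 1) * binom (((m : ℤ) + 2 * i + 1) / 2) (((m : ℤ) - 2 * i - 1) / 2)

/-- The coefficients `δ_{m,i}`. The divisions by `2` inside the binomials are exact, and the
quotient `m / (m + 2i)` is read as `1` when `m = i = 0`. -/
def deltaCoeff (m i : ℕ) : ℚ :=
  if Even m then
    (if m = 0 ∧ i = 0 then 1 else (m : ℚ) * 2 ^ i / ((m : ℚ) + 2 * i)) *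
      binom (((m : ℤ) + 2 * i) / 2) (((m : ℤ) - 2 * i) / 2)
  else
    2 ^ i * binom (((m : ℤ) + 2 * i - 1) / 2) (((m : ℤ) - 2 * i - 1) / 2)

/-- `ā_m(t) = ∑_i (-1)^i α_{m,i} t^i`. -/
def aBar (m : ℕ) : PowerSeries ℚ := PowerSeries.mk fun i => (-1) ^ i * alphaCoeff m i

/-- `d_m(t) = ∑_i (-1)^i δ_{m,i} t^i`. -/
def dSeries (m : ℕ) : PowerSeries ℚ := PowerSeries.mk fun i => (-1) ^ i * deltaCoeff m i

/-! ### Recurrences for `a_m` and `b_m` -/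

/-! Since ζ^{m+1}(u, w) is the sum of ζ^m(v, w) over u ≤ v ≤ w, induction on m reduces the
generating function to summing a^{l_1(v)} b^{l_2(v)} over all v ≥ u, with a = a_m and b = b_m. Embed
u greedily from the left: a letter 1 takes the next letter, contributing a + b; a letter 2 skips a
run of ones and takes a 2, contributing b / (1 - a); the remaining tail is free, contributing 1 / (1
- a - b). These are the recurrences a_{m+1} = a_m + b_m and b_{m+1} = b_m / (1 - a_m) coming from f
(`Word.pow_dvd_upperSum_sub`, `zetaPowLengthSeries_eq`).

For the closed forms, Pascal's rule gives t ā_m = d_m - d_{m+2}, so the claim is 1 - a_m = d_{m+2} /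
d_m and b_m = t / (d_m d_{m+1}). The recurrence for b is then immediate, and the one for a becomes
d_{m+1} d_{m+2} - d_m d_{m+3} = t (`dSeries_quadratic`). This follows from a linear recurrence for
the odd-indexed d_m, with each d_{2k+2} the mean of its two neighbours. -/

theorem letter_two_eq (c : Letter 2) : c = letterOne ∨ c = letterTwo := by
  obtain ⟨k, h1, h2⟩ := c
  have : k = 1 ∨ k = 2 := by omega
  rcases this with rfl | rfl
  · exact Or.inl rfl
  · exact Or.inr rfl

theorem letterOne_ne_letterTwo : letterOne ≠ letterTwo := by
  simp [letterOne, letterTwo]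

theorem univ_letter_two : (Finset.univ : Finset (Letter 2)) = {letterOne, letterTwo} := by
  ext c
  simpa using letter_two_eq c

theorem substImage_letterOne :
    substImage 2 letterOne = MvPowerSeries.X letterOne + MvPowerSeries.X letterTwo := by
  have h1 : ({j : Letter 2 | letterOne.1 ≤ j.1} : Finset (Letter 2)) = {letterOne, letterTwo} := by
    rw [univ_letter_two]; rfl
  have h2 : ({j : Letter 2 | j.1 < letterOne.1} : Finset (Letter 2)) = ∅ := by
    rw [univ_letter_two]; rfl
  rw [substImage, h1, h2, Finset.sum_pair letterOne_ne_letterTwo, Finset.sum_empty, sub_zero,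
    MvPowerSeries.inv_eq_iff_mul_eq_one (by simp) |>.2 (one_mul 1), mul_one]

theorem substImage_letterTwo :
    substImage 2 letterTwo * (1 - MvPowerSeries.X letterOne) = MvPowerSeries.X letterTwo := by
  have h1 : ({j : Letter 2 | letterTwo.1 ≤ j.1} : Finset (Letter 2)) = {letterTwo} := by
    rw [univ_letter_two]; rfl
  have h2 : ({j : Letter 2 | j.1 < letterTwo.1} : Finset (Letter 2)) = {letterOne} := by
    rw [univ_letter_two]; rfl
  rw [substImage, h1, h2, Finset.sum_singleton, Finset.sum_singleton, mul_assoc,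
    MvPowerSeries.inv_mul_cancel _ (by simp), mul_one]

/-- The `m`-th iterate of the substitution followed by the length specialization. -/
noncomputable def iterSpec (n m : ℕ) : MvPowerSeries (Letter n) ℚ →+* PowerSeries ℚ :=
  (MvPowerSeries.substAlgHom (R := ℚ) (hasSubst_lengthSpec n)).toRingHom.comp
    ((MvPowerSeries.substAlgHom (R := ℚ) (hasSubst_substImage n)).toRingHom ^ m)

theorem iterSpec_apply (n m : ℕ) (p : MvPowerSeries (Letter n) ℚ) :
    iterSpec n m p = lengthSpec n ((substMap n)^[m] p) := by
  have h : ⇑(MvPowerSeries.substAlgHom (R := ℚ) (hasSubst_substImage n)).toRingHom = substMap n :=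
    MvPowerSeries.coe_substAlgHom (hasSubst_substImage n)
  have h' : ⇑(MvPowerSeries.substAlgHom (R := ℚ) (hasSubst_lengthSpec n)).toRingHom =
      lengthSpec n := MvPowerSeries.coe_substAlgHom (hasSubst_lengthSpec n)
  rw [iterSpec, RingHom.comp_apply, RingHom.coe_pow, h, h']

/-- The innermost f is peeled off, so the remaining map is a ring homomorphism and carries the
relations for f(x), f(y) to recurrences in m. -/
theorem lengthSpec_iterate_succ_X (n m : ℕ) (k : Letter n) :
    lengthSpec n ((substMap n)^[m + 1] (MvPowerSeries.X k)) = iterSpec n m (substImage n k) := by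
  rw [iterSpec_apply, Function.iterate_succ_apply]
  congr 2
  exact MvPowerSeries.subst_X (hasSubst_substImage n) k

theorem aSeries_zero : aSeries 0 = PowerSeries.X :=
  MvPowerSeries.subst_X (hasSubst_lengthSpec 2) letterOne

theorem bSeries_zero : bSeries 0 = PowerSeries.X :=
  MvPowerSeries.subst_X (hasSubst_lengthSpec 2) letterTwo

theorem iterSpec_letterOne (m : ℕ) : iterSpec 2 m (MvPowerSeries.X letterOne) = aSeries m :=
  iterSpec_apply 2 m _

theorem iterSpec_letterTwo (m : ℕ) : iterSpec 2 m (MvPowerSeries.X letterTwo) = bSeries m :=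
  iterSpec_apply 2 m _

theorem aSeries_succ (m : ℕ) : aSeries (m + 1) = aSeries m + bSeries m := by
  rw [aSeries, lengthSpec_iterate_succ_X, substImage_letterOne, map_add, iterSpec_letterOne,
    iterSpec_letterTwo]

theorem bSeries_succ_mul (m : ℕ) : bSeries (m + 1) * (1 - aSeries m) = bSeries m := by
  rw [bSeries, lengthSpec_iterate_succ_X, ← iterSpec_letterOne, ← map_one (iterSpec 2 m),
    ← map_sub, ← map_mul, substImage_letterTwo, iterSpec_letterTwo]

theorem constantCoeff_aSeries_bSeries (m : ℕ) :
    PowerSeries.constantCoeff (aSeries m) = 0 ∧ PowerSeries.constantCoeff (bSeries m) = 0 := by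
  induction m with
  | zero => simp [aSeries_zero, bSeries_zero]
  | succ m ih =>
    have h := congrArg PowerSeries.constantCoeff (bSeries_succ_mul m)
    rw [map_mul, map_sub, map_one, ih.1, ih.2, sub_zero, mul_one] at h
    exact ⟨by rw [aSeries_succ, map_add, ih.1, ih.2, add_zero], h⟩

theorem constantCoeff_one_sub_aSeries_sub_bSeries (m : ℕ) :
    PowerSeries.constantCoeff (1 - aSeries m - bSeries m) = 1 := by
  simp [constantCoeff_aSeries_bSeries m]

/-! ### Sums over upper sets of words -/

namespace Word

theorem nil_le {n : ℕ} (w : Word n) : (⟨[]⟩ : Word n) ≤ w :=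
  (le_iff_sublistForall _ _).2 List.SublistForall₂.nil

theorem cons_not_le_nil {n : ℕ} (c : Letter n) (u : List (Letter n)) :
    ¬ (⟨c :: u⟩ : Word n) ≤ ⟨[]⟩ := fun h => by
  simpa [length] using length_le_of_le h

/-- The greedy description of the order: the first letter of `w` that can be matched with the first
letter of `u` may be matched with it. -/
theorem cons_le_cons_iff {n : ℕ} (c d : Letter n) (u w : List (Letter n)) :
    (⟨c :: u⟩ : Word n) ≤ ⟨d :: w⟩ ↔
      if c ≤ d then (⟨u⟩ : Word n) ≤ ⟨w⟩ else (⟨c :: u⟩ : Word n) ≤ ⟨w⟩ := by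
  simp only [le_iff_sublistForall]
  split_ifs with hcd
  · refine ⟨fun h => ?_, List.SublistForall₂.cons hcd⟩
    cases h with
    | cons _ h => exact h
    -- An embedding of `c :: u` that skips `d` restricts to one of `u`.
    | cons_right h =>
      exact List.SublistForall₂.is_trans.trans _ _ _
        (List.SublistForall₂.cons_right (List.SublistForall₂.is_refl.refl u)) h
  · refine ⟨fun h => ?_, List.SublistForall₂.cons_right⟩
    cases h with
    | cons h _ => exact absurd h hcd
    | cons_right h => exact h

theorem ofLength_zero (n : ℕ) : ofLength n 0 = {⟨[]⟩} := by
  ext w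
  simp [mem_ofLength, length, Word.ext_iff]

theorem sum_ofLength_succ {n : ℕ} {M : Type*} [AddCommMonoid M] (N : ℕ) (g : Word n → M) :
    ∑ w ∈ ofLength n (N + 1), g w = ∑ c, ∑ w ∈ ofLength n N, g ⟨c :: w.letters⟩ := by
  rw [← Finset.sum_product']
  symm
  refine Finset.sum_bij (fun p _ => ⟨p.1 :: p.2.letters⟩) ?_ ?_ ?_ (fun _ _ => rfl)
  · rintro ⟨c, w⟩ h
    simp only [mem_product, mem_ofLength, length] at h
    simp [mem_ofLength, length, h.2]
  · rintro ⟨c, w⟩ _ ⟨c', w'⟩ _ h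
    simpa [Word.ext_iff] using h
  · rintro ⟨_ | ⟨c, w⟩⟩ h
    · simp [mem_ofLength, length] at h
    · refine ⟨(c, ⟨w⟩), ?_, rfl⟩
      simpa [mem_ofLength, length] using h

theorem sum_ofLength_succ_two {M : Type*} [AddCommMonoid M] (N : ℕ) (g : Word 2 → M) :
    ∑ w ∈ ofLength 2 (N + 1), g w =
      ∑ w ∈ ofLength 2 N, g ⟨letterOne :: w.letters⟩ +
        ∑ w ∈ ofLength 2 N, g ⟨letterTwo :: w.letters⟩ := by
  rw [sum_ofLength_succ, univ_letter_two, Finset.sum_pair letterOne_ne_letterTwo]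

variable {R : Type*} [CommRing R]

/-- The monomial `a^{l_1} b^{l_2}` of a word with `l_1` ones and `l_2` twos. -/
def weight (a b : R) (w : Word 2) : R := a ^ w.mult letterOne * b ^ w.mult letterTwo

theorem weight_nil (a b : R) : weight a b ⟨[]⟩ = 1 := by
  simp [weight, mult]

theorem weight_one_cons (a b : R) (w : List (Letter 2)) :
    weight a b ⟨letterOne :: w⟩ = a * weight a b ⟨w⟩ := by
  simp [weight, mult, letterOne_ne_letterTwo]
  ring

theorem weight_two_cons (a b : R) (w : List (Letter 2)) :
    weight a b ⟨letterTwo :: w⟩ = b * weight a b ⟨w⟩ := by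
  simp [weight, mult, letterOne_ne_letterTwo.symm]
  ring

theorem mult_add_mult (w : Word 2) : w.mult letterOne + w.mult letterTwo = w.length := by
  obtain ⟨w⟩ := w
  induction w with
  | nil => rfl
  | cons c w ih =>
    simp only [mult, length, List.length_cons] at ih ⊢
    rcases letter_two_eq c with rfl | rfl <;>
      simp [letterOne_ne_letterTwo, letterOne_ne_letterTwo.symm] <;> omega

/-- The total weight of the words of length `N` above `u`. -/
noncomputable def levelSum (a b : R) (u : Word 2) (N : ℕ) : R :=
  ∑ w ∈ ofLength 2 N, if u ≤ w then weight a b w else 0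

/-- The total weight of the words of length less than `N` above `u`. -/
noncomputable def upperSum (a b : R) (u : Word 2) (N : ℕ) : R :=
  ∑ k ∈ range N, levelSum a b u k

theorem levelSum_nil_zero (a b : R) : levelSum a b ⟨[]⟩ 0 = 1 := by
  simp [levelSum, ofLength_zero, weight_nil]

theorem levelSum_cons_zero (a b : R) (c : Letter 2) (u : List (Letter 2)) :
    levelSum a b ⟨c :: u⟩ 0 = 0 := by
  simp [levelSum, ofLength_zero, cons_not_le_nil]

theorem levelSum_nil_succ (a b : R) (N : ℕ) :
    levelSum a b ⟨[]⟩ (N + 1) = (a + b) * levelSum a b ⟨[]⟩ N := by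
  simp only [levelSum, sum_ofLength_succ_two, nil_le, if_true, weight_one_cons, weight_two_cons]
  rw [add_mul, Finset.mul_sum, Finset.mul_sum]

theorem levelSum_one_cons_succ (a b : R) (u : List (Letter 2)) (N : ℕ) :
    levelSum a b ⟨letterOne :: u⟩ (N + 1) = (a + b) * levelSum a b ⟨u⟩ N := by
  have h : letterOne ≤ letterTwo := (one_le_two : (1 : ℕ) ≤ 2)
  simp only [levelSum, sum_ofLength_succ_two, cons_le_cons_iff, le_refl, h, if_true,
    weight_one_cons, weight_two_cons]
  rw [add_mul, Finset.mul_sum, Finset.mul_sum]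
  simp only [mul_ite, mul_zero]

/-- A leading 1 of the larger word cannot cover the 2 and is skipped; iterating this yields the
geometric factor 1 / (1 - a). -/
theorem levelSum_two_cons_succ (a b : R) (u : List (Letter 2)) (N : ℕ) :
    levelSum a b ⟨letterTwo :: u⟩ (N + 1) =
      a * levelSum a b ⟨letterTwo :: u⟩ N + b * levelSum a b ⟨u⟩ N := by
  have h : ¬ letterTwo ≤ letterOne := not_le.2 (one_lt_two : (1 : ℕ) < 2)
  simp only [levelSum, sum_ofLength_succ_two, cons_le_cons_iff, le_refl, h, if_true, if_false,
    weight_one_cons, weight_two_cons]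
  rw [Finset.mul_sum, Finset.mul_sum]
  simp only [mul_ite, mul_zero]

theorem upperSum_nil_succ (a b : R) (N : ℕ) :
    upperSum a b ⟨[]⟩ (N + 1) = 1 + (a + b) * upperSum a b ⟨[]⟩ N := by
  rw [upperSum, Finset.sum_range_succ', levelSum_nil_zero, add_comm, upperSum, Finset.mul_sum]
  simp only [levelSum_nil_succ]

theorem upperSum_one_cons_succ (a b : R) (u : List (Letter 2)) (N : ℕ) :
    upperSum a b ⟨letterOne :: u⟩ (N + 1) = (a + b) * upperSum a b ⟨u⟩ N := by
  rw [upperSum, Finset.sum_range_succ', levelSum_cons_zero, add_zero, upperSum, Finset.mul_sum]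
  simp only [levelSum_one_cons_succ]

theorem upperSum_two_cons_succ (a b : R) (u : List (Letter 2)) (N : ℕ) :
    upperSum a b ⟨letterTwo :: u⟩ (N + 1) =
      a * upperSum a b ⟨letterTwo :: u⟩ N + b * upperSum a b ⟨u⟩ N := by
  rw [upperSum, Finset.sum_range_succ', levelSum_cons_zero, add_zero, upperSum, upperSum,
    Finset.mul_sum, Finset.mul_sum, ← Finset.sum_add_distrib]
  simp only [levelSum_two_cons_succ]

/-- Modulo `x^N`, the total weight of the words of length less than `N` above `u` is
`(a + b)^{l_1} (b / (1 - a))^{l_2} / (1 - a - b)`, where `c = b / (1 - a)` and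
`p = 1 / (1 - a - b)`. -/
theorem pow_dvd_upperSum_sub {x a b c p : R} (ha : x ∣ a) (hb : x ∣ b) (hc : c * (1 - a) = b)
    (hp : (1 - a - b) * p = 1) (N : ℕ) (u : Word 2) :
    x ^ N ∣ upperSum a b u N - weight (a + b) c u * p := by
  induction N generalizing u with
  | zero => simp
  | succ N ih =>
    have hab := dvd_add ha hb
    -- Each recurrence multiplies the error at `N` by a, b or a + b, hence gains a factor x. The
    -- limits obey the same recurrences: p = 1 + (a + b) p and c = a c + b.
    rw [pow_succ']
    obtain ⟨_ | ⟨d, u⟩⟩ := u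
    · have h := mul_dvd_mul hab (ih ⟨[]⟩)
      rw [weight_nil] at h ⊢
      rw [upperSum_nil_succ]
      convert h using 1
      linear_combination -hp
    · rcases letter_two_eq d with rfl | rfl
      · have h := mul_dvd_mul hab (ih ⟨u⟩)
        rw [upperSum_one_cons_succ, weight_one_cons]
        convert h using 1
        ring
      · have h := dvd_add (mul_dvd_mul ha (ih ⟨letterTwo :: u⟩)) (mul_dvd_mul hb (ih ⟨u⟩))
        rw [weight_two_cons] at h
        rw [upperSum_two_cons_succ, weight_two_cons]
        convert h using 1
        linear_combination -weight (a + b) c ⟨u⟩ * p * hc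

end Word

/-! ### Powers of the zeta function -/

theorem zetaPow_zero_apply (n : ℕ) (u w : Word n) : zetaPow n 0 u w = if u = w then 1 else 0 := by
  rw [zetaPow, pow_zero, IncidenceAlgebra.one_apply]

/-- The extra ζ is split off on the left, so `w` stays fixed and induction runs over the lower
endpoint. -/
theorem zetaPow_succ_apply (n m : ℕ) (u w : Word n) :
    zetaPow n (m + 1) u w = ∑ v ∈ Icc u w, zetaPow n m v w := by
  rw [zetaPow, pow_succ', IncidenceAlgebra.mul_apply]
  refine Finset.sum_congr rfl fun v hv => ?_
  rw [IncidenceAlgebra.zeta_of_le (Finset.mem_Icc.1 hv).1, one_mul, zetaPow]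

/-- Words `v` not below `w` contribute zero, so the index set can be made to depend only on the
length of `w`; the sums over `v` and `w` can then be exchanged. -/
theorem zetaPow_succ_apply_eq_sum_range (n m : ℕ) (u w : Word n) :
    zetaPow n (m + 1) u w = ∑ k ∈ range (w.length + 1), ∑ v ∈ Word.ofLength n k,
      if u ≤ v then zetaPow n m v w else 0 := by
  have hd : (range (w.length + 1) : Set ℕ).PairwiseDisjoint (Word.ofLength n) := by
    intro i _ j _ hij
    refine Finset.disjoint_left.2 fun v hi hj => hij ?_
    rw [← Word.mem_ofLength.1 hi, ← Word.mem_ofLength.1 hj]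
  rw [zetaPow_succ_apply, ← Finset.sum_biUnion hd, ← Finset.sum_filter]
  refine Finset.sum_subset (fun v hv => ?_) fun v hv hv' => ?_
  · obtain ⟨h1, h2⟩ := Finset.mem_Icc.1 hv
    have := Word.length_le_of_le h2
    simp only [mem_filter, mem_biUnion, mem_range, Word.mem_ofLength]
    exact ⟨⟨_, by omega, rfl⟩, h1⟩
  · refine IncidenceAlgebra.apply_eq_zero_of_not_le (fun h => hv' ?_) _
    exact Finset.mem_Icc.2 ⟨(Finset.mem_filter.1 hv).2, h⟩

theorem coeff_zetaPowLengthSeries_succ (n m N : ℕ) (u : Word n) :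
    PowerSeries.coeff N (zetaPowLengthSeries n (m + 1) u) =
      ∑ k ∈ range (N + 1), ∑ v ∈ Word.ofLength n k,
        if u ≤ v then PowerSeries.coeff N (zetaPowLengthSeries n m v) else 0 := by
  simp only [zetaPowLengthSeries, PowerSeries.coeff_mk]
  have h : ∑ w ∈ Word.ofLength n N, zetaPow n (m + 1) u w =
      ∑ w ∈ Word.ofLength n N, ∑ k ∈ range (N + 1), ∑ v ∈ Word.ofLength n k,
        if u ≤ v then zetaPow n m v w else 0 :=
    Finset.sum_congr rfl fun w hw => by
      rw [zetaPow_succ_apply_eq_sum_range, Word.mem_ofLength.1 hw]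
  rw [h, Finset.sum_comm, Int.cast_sum]
  refine Finset.sum_congr rfl fun k _ => ?_
  rw [Finset.sum_comm, Int.cast_sum]
  refine Finset.sum_congr rfl fun v _ => ?_
  split_ifs <;> simp

theorem zetaPowLengthSeries_zero (n : ℕ) (u : Word n) :
    zetaPowLengthSeries n 0 u = PowerSeries.X ^ u.length := by
  ext N
  simp [zetaPowLengthSeries, zetaPow_zero_apply, PowerSeries.coeff_X_pow, Word.mem_ofLength,
    eq_comm]

theorem zetaPowLengthSeries_eq (u : Word 2) (m : ℕ) :
    zetaPowLengthSeries 2 m u =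
      aSeries m ^ u.mult letterOne * bSeries m ^ u.mult letterTwo *
        ∏ i ∈ Finset.range m, (1 - aSeries i - bSeries i)⁻¹ := by
  induction m generalizing u with
  | zero =>
    rw [zetaPowLengthSeries_zero, aSeries_zero, bSeries_zero, ← pow_add, Word.mult_add_mult,
      Finset.range_zero, Finset.prod_empty, mul_one]
  | succ m ih =>
    set P := ∏ i ∈ Finset.range m, (1 - aSeries i - bSeries i)⁻¹ with hP
    have hdvd := Word.pow_dvd_upperSum_sub
      (PowerSeries.X_dvd_iff.2 (constantCoeff_aSeries_bSeries m).1)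
      (PowerSeries.X_dvd_iff.2 (constantCoeff_aSeries_bSeries m).2) (bSeries_succ_mul m)
      (PowerSeries.mul_inv_cancel (1 - aSeries m - bSeries m)
        (by rw [constantCoeff_one_sub_aSeries_sub_bSeries]; exact one_ne_zero))
    ext N
    -- The coefficient of t^N involves only words `v` of length at most `N`, hence the truncation at
    -- `N + 1`.
    have hN := PowerSeries.X_pow_dvd_iff.1 ((hdvd (N + 1) u).mul_right P) N N.lt_succ_self
    rw [sub_mul, map_sub, sub_eq_zero] at hN
    rw [Finset.prod_range_succ, ← hP, coeff_zetaPowLengthSeries_succ]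
    simp only [ih]
    rw [← aSeries_succ, Word.weight] at hN
    rw [mul_comm P, ← mul_assoc, ← hN, Word.upperSum, Finset.sum_mul, map_sum]
    refine Finset.sum_congr rfl fun k _ => ?_
    rw [Word.levelSum, Finset.sum_mul, map_sum]
    refine Finset.sum_congr rfl fun v _ => ?_
    split_ifs <;> simp [Word.weight]

/-! ### The polynomials `d_m` and `ā_m` -/

theorem binom_natCast (p q : ℕ) : binom p q = (p.choose q : ℚ) := by
  simp [binom]

/-- Symmetry makes the lower index independent of `k`, ready for Pascal's rule; for `i > k` both
sides vanish. -/
theorem binom_add_sub (k i : ℕ) : binom ((k : ℤ) + i) ((k : ℤ) - i) =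
    ((k + i).choose (2 * i) : ℚ) := by
  rcases le_or_gt i k with h | h
  · rw [← Nat.cast_sub h, ← Nat.cast_add, binom_natCast,
      Nat.choose_symm_of_eq_add (show k + i = k - i + 2 * i by omega)]
  · rw [binom, if_neg (by omega), Nat.choose_eq_zero_of_lt (by omega), Nat.cast_zero]

theorem binom_add_succ_sub (k i : ℕ) :
    binom ((k : ℤ) + i + 1) ((k : ℤ) - i) = ((k + i + 1).choose (2 * i + 1) : ℚ) := by
  rcases le_or_gt i k with h | h
  · rw [← Nat.cast_sub h, ← Nat.cast_add, ← Nat.cast_add_one, binom_natCast,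
      Nat.choose_symm_of_eq_add (show k + i + 1 = k - i + (2 * i + 1) by omega)]
  · rw [binom, if_neg (by omega), Nat.choose_eq_zero_of_lt (by omega), Nat.cast_zero]

theorem deltaCoeff_odd (k i : ℕ) :
    deltaCoeff (2 * k + 1) i = 2 ^ i * ((k + i).choose (2 * i) : ℚ) := by
  rw [deltaCoeff, if_neg (by simp), ← binom_add_sub]
  congr 2 <;> push_cast <;> omega

theorem deltaCoeff_zero_left (i : ℕ) : deltaCoeff 0 i = if i = 0 then 1 else 0 := by
  rcases i with _ | i <;> simp [deltaCoeff, binom]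

/-- The ratio of the two binomials on the right is (k + 1 - i) / (k + 1 + i), and adding 1 to it
gives the factor 2(k + 1) / (k + 1 + i). -/
theorem two_mul_deltaCoeff_even (k i : ℕ) :
    2 * deltaCoeff (2 * k + 2) i =
      2 ^ i * (((k + i).choose (2 * i) : ℚ) + ((k + 1 + i).choose (2 * i) : ℚ)) := by
  have e : binom ((((2 * k + 2 : ℕ) : ℤ) + 2 * i) / 2) ((((2 * k + 2 : ℕ) : ℤ) - 2 * i) / 2) =
      ((k + 1 + i).choose (2 * i) : ℚ) := by
    rw [← binom_add_sub]
    congr 1 <;> push_cast <;> omega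
  have hc : ((k + i).choose (2 * i) : ℚ) * (k + 1 + i) =
      ((k + 1 + i).choose (2 * i) : ℚ) * (k + 1 - i) := by
    rcases le_or_gt (2 * i) (k + i + 1) with h | h
    · have := Nat.choose_mul_succ_eq (k + i) (2 * i)
      have h' : (((k + i).choose (2 * i) * (k + i + 1) : ℕ) : ℚ) =
        (((k + i + 1).choose (2 * i) * (k + i + 1 - 2 * i) : ℕ) : ℚ) := by rw [this]
      push_cast [Nat.cast_sub h] at h'
      rw [show k + 1 + i = k + i + 1 by ring]
      linear_combination h'
    · rw [Nat.choose_eq_zero_of_lt (by omega : k + i < 2 * i),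
        Nat.choose_eq_zero_of_lt (by omega : k + 1 + i < 2 * i)]
      simp
  have hne : (k : ℚ) + 1 + i ≠ 0 := by positivity
  have hne' : ((2 * k + 2 : ℕ) : ℚ) + 2 * i ≠ 0 := by positivity
  rw [deltaCoeff, if_pos (by simp [parity_simps]), if_neg (by omega), e]
  rw [div_mul_eq_mul_div, ← mul_div_assoc, div_eq_iff hne']
  push_cast
  linear_combination -2 * 2 ^ i * hc

theorem alphaCoeff_odd (k i : ℕ) :
    alphaCoeff (2 * k + 1) i = 2 ^ (i + 1) * ((k + i + 1).choose (2 * i + 1) : ℚ) := by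
  rw [alphaCoeff, if_neg (by simp), ← binom_add_succ_sub]
  congr 2 <;> push_cast <;> omega

theorem alphaCoeff_even (k i : ℕ) :
    alphaCoeff (2 * k) i =
      2 ^ i * (((k + i + 1).choose (2 * i + 1) : ℚ) + ((k + i).choose (2 * i + 1) : ℚ)) := by
  have e : binom ((((2 * k : ℕ) : ℤ) + 2 * i) / 2) ((((2 * k : ℕ) : ℤ) - 2 * i) / 2) =
      ((k + i).choose (2 * i) : ℚ) := by
    rw [← binom_add_sub]
    congr 1 <;> push_cast <;> omega
  have h1 : ((k + i + 1).choose (2 * i + 1) : ℚ) * (2 * i + 1) =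
      (k + i + 1) * ((k + i).choose (2 * i) : ℚ) := by
    exact_mod_cast (Nat.add_one_mul_choose_eq (k + i) (2 * i)).symm
  have h2 : ((k + i + 1).choose (2 * i + 1) : ℚ) =
      ((k + i).choose (2 * i) : ℚ) + ((k + i).choose (2 * i + 1) : ℚ) := by
    exact_mod_cast Nat.choose_succ_succ (k + i) (2 * i)
  have hne : (2 * (i : ℚ) + 1) ≠ 0 := by positivity
  rw [alphaCoeff, if_pos (by simp), e, div_mul_eq_mul_div, div_eq_iff hne]
  push_cast
  linear_combination 2 ^ i * (2 * i + 1) * h2 - 2 * 2 ^ i * h1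

/-- Pascal's rule relating the coefficients of `ā_m` to those of `d_m` and `d_{m+2}`. -/
theorem alphaCoeff_eq_sub (m i : ℕ) :
    alphaCoeff m i = deltaCoeff (m + 2) (i + 1) - deltaCoeff m (i + 1) := by
  have pascal (p q : ℕ) : ((p + 1).choose (q + 1) : ℚ) =
      (p.choose q : ℚ) + (p.choose (q + 1) : ℚ) := by
    exact_mod_cast Nat.choose_succ_succ p q
  obtain ⟨k, rfl | rfl⟩ := Nat.even_or_odd' m
  · have h2 := two_mul_deltaCoeff_even k (i + 1)
    rw [alphaCoeff_even]
    rw [show k + 1 + (i + 1) = k + i + 1 + 1 by ring, show k + (i + 1) = k + i + 1 by ring,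
      show 2 * (i + 1) = 2 * i + 1 + 1 by ring] at h2
    -- The averaging formula does not reach δ_{0,i}, so m = 0 is treated apart.
    rcases k with _ | k
    · rw [mul_zero, deltaCoeff_zero_left, if_neg (by omega)]
      have z1 : (0 + i).choose (2 * i + 1) = 0 := Nat.choose_eq_zero_of_lt (by omega)
      have z2 : (0 + i + 1).choose (2 * i + 1 + 1) = 0 := Nat.choose_eq_zero_of_lt (by omega)
      rw [z2, pascal, z2] at h2
      rw [z1]
      push_cast at h2 ⊢
      linear_combination -h2 / 2
    · have h1 := two_mul_deltaCoeff_even k (i + 1)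
      rw [show k + 1 + (i + 1) = k + 1 + i + 1 by ring, show k + (i + 1) = k + 1 + i by ring,
        show 2 * (i + 1) = 2 * i + 1 + 1 by ring] at h1
      have p1 := pascal (k + 1 + i + 1) (2 * i + 1)
      have p2 := pascal (k + 1 + i) (2 * i + 1)
      rw [show 2 * (k + 1) = 2 * k + 2 by ring] at h2 ⊢
      linear_combination h1 / 2 - h2 / 2 - 2 ^ i * p1 - 2 ^ i * p2
  · rw [alphaCoeff_odd, show 2 * k + 1 + 2 = 2 * (k + 1) + 1 by ring, deltaCoeff_odd,
      deltaCoeff_odd, show k + 1 + (i + 1) = k + i + 1 + 1 by ring,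
      show k + (i + 1) = k + i + 1 by ring, show 2 * (i + 1) = 2 * i + 1 + 1 by ring, pascal (k + i + 1)]
    ring

theorem deltaCoeff_zero_right (m : ℕ) : deltaCoeff m 0 = 1 := by
  obtain ⟨k, rfl | rfl⟩ := Nat.even_or_odd' m
  · rcases k with _ | k
    · exact deltaCoeff_zero_left 0
    · have h := two_mul_deltaCoeff_even k 0
      rw [show 2 * (k + 1) = 2 * k + 2 by ring]
      norm_num at h
      linarith
  · simp [deltaCoeff_odd]

theorem constantCoeff_dSeries (m : ℕ) : PowerSeries.constantCoeff (dSeries m) = 1 := by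
  rw [← PowerSeries.coeff_zero_eq_constantCoeff_apply, dSeries, PowerSeries.coeff_mk,
    deltaCoeff_zero_right, pow_zero, one_mul]

theorem X_mul_aBar (m : ℕ) : PowerSeries.X * aBar m = dSeries m - dSeries (m + 2) := by
  ext i
  rcases i with _ | i
  · simp [constantCoeff_dSeries]
  · rw [PowerSeries.coeff_succ_X_mul, map_sub, aBar, dSeries, dSeries]
    simp only [PowerSeries.coeff_mk]
    rw [alphaCoeff_eq_sub]
    ring

/-! ### Linear and quadratic relations among the d_m -/

theorem dSeries_zero : dSeries 0 = 1 := by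
  ext i
  rw [dSeries, PowerSeries.coeff_mk, deltaCoeff_zero_left, PowerSeries.coeff_one]
  split_ifs with h <;> simp [h]

theorem two_mul_dSeries_even (k : ℕ) :
    2 * dSeries (2 * k + 2) = dSeries (2 * k + 1) + dSeries (2 * k + 3) := by
  ext i
  rw [two_mul, map_add, map_add]
  simp only [dSeries, PowerSeries.coeff_mk]
  have h := two_mul_deltaCoeff_even k i
  rw [show 2 * k + 3 = 2 * (k + 1) + 1 by ring, deltaCoeff_odd, deltaCoeff_odd]
  linear_combination (-1) ^ i * h

/-- The second difference in k of C(k+i, 2i) is C(k+i, 2i-2), which belongs to index i - 1 at k + 1;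
the sign and power of 2 supply the factor -2. -/
theorem dSeries_odd_recurrence (k : ℕ) :
    dSeries (2 * k + 5) =
      2 * dSeries (2 * k + 3) - 2 * (PowerSeries.X * dSeries (2 * k + 3)) -
        dSeries (2 * k + 1) := by
  have pascal (p q : ℕ) : ((p + 1).choose (q + 1) : ℚ) =
      (p.choose q : ℚ) + (p.choose (q + 1) : ℚ) := by
    exact_mod_cast Nat.choose_succ_succ p q
  ext i
  rw [two_mul (dSeries _), two_mul (PowerSeries.X * _), map_sub, map_sub, map_add, map_add]
  rcases i with _ | i
  · simp [constantCoeff_dSeries]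
  · rw [PowerSeries.coeff_succ_X_mul]
    simp only [dSeries, PowerSeries.coeff_mk]
    rw [show 2 * k + 5 = 2 * (k + 2) + 1 by ring, show 2 * k + 3 = 2 * (k + 1) + 1 by ring]
    simp only [deltaCoeff_odd]
    rw [show k + 2 + (i + 1) = k + 1 + i + 1 + 1 by ring,
      show k + 1 + (i + 1) = k + 1 + i + 1 by ring, show k + (i + 1) = k + 1 + i by ring,
      show 2 * (i + 1) = 2 * i + 1 + 1 by ring]
    simp only [pascal]
    ring

theorem dSeries_one : dSeries 1 = 1 := by
  ext i
  have h := deltaCoeff_odd 0 i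
  rw [mul_zero, zero_add] at h
  rw [dSeries, PowerSeries.coeff_mk, h, PowerSeries.coeff_one]
  rcases i with _ | i
  · simp
  · simp [Nat.choose_eq_zero_of_lt (by omega : i + 1 < 2 * (i + 1))]

theorem dSeries_three : dSeries 3 = 1 - 2 * PowerSeries.X := by
  ext i
  have h := deltaCoeff_odd 1 i
  rw [mul_one] at h
  rw [dSeries, PowerSeries.coeff_mk, h, map_sub, two_mul PowerSeries.X, map_add, PowerSeries.coeff_one,
    PowerSeries.coeff_X]
  rcases i with _ | _ | i
  · simp
  · norm_num
  · rw [Nat.choose_eq_zero_of_lt (by omega)]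
    simp

theorem two_ne_zero_powerSeries : (2 : PowerSeries ℚ) ≠ 0 := fun h => by
  have := congrArg PowerSeries.constantCoeff h
  rw [map_ofNat, map_zero] at this
  exact two_ne_zero this

/-- The form p² + q² - (2 - 2t)pq is invariant under the recurrence step (p, q) ↦ (q, (2 - 2t)q -
p); its value is read off at (1, 1 - 2t). -/
theorem dSeries_odd_quadratic (k : ℕ) :
    dSeries (2 * k + 1) ^ 2 + dSeries (2 * k + 3) ^ 2 -
      (2 - 2 * PowerSeries.X) * dSeries (2 * k + 1) * dSeries (2 * k + 3) =
        2 * PowerSeries.X := by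
  induction k with
  | zero =>
    rw [mul_zero, zero_add, zero_add, dSeries_one, dSeries_three]
    ring
  | succ k ih =>
    rw [show 2 * (k + 1) + 1 = 2 * k + 3 by ring, show 2 * (k + 1) + 3 = 2 * k + 5 by ring,
      dSeries_odd_recurrence]
    linear_combination ih

/-- Four consecutive terms of the sequence `d_m` satisfy a quadratic relation. -/
theorem dSeries_quadratic (m : ℕ) :
    dSeries (m + 1) * dSeries (m + 2) - dSeries m * dSeries (m + 3) = PowerSeries.X := by
  -- With p, q, r consecutive odd-indexed terms, doubling and averaging turn the left side into q² -
  -- pr in both parities; as r = (2 - 2t)q - p, this is the invariant form. Only m = 0 needs a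
  -- direct check.
  refine mul_left_cancel₀ two_ne_zero_powerSeries ?_
  obtain ⟨k, rfl | rfl⟩ := Nat.even_or_odd' m
  · rcases k with _ | k
    · have h := two_mul_dSeries_even 0
      simp only [mul_zero, zero_add, dSeries_zero, dSeries_one, dSeries_three] at h ⊢
      linear_combination h
    · rw [show 2 * (k + 1) + 1 = 2 * k + 3 by ring,
        show 2 * (k + 1) + 3 = 2 * k + 5 by ring]
      have h1 := two_mul_dSeries_even k
      have h2 := two_mul_dSeries_even (k + 1)
      rw [show 2 * (k + 1) + 1 = 2 * k + 3 by ring,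
        show 2 * (k + 1) + 3 = 2 * k + 5 by ring] at h2
      rw [show 2 * (k + 1) = 2 * k + 2 by ring] at h2 ⊢
      have h3 := dSeries_odd_recurrence k
      linear_combination dSeries (2 * k + 3) * h2 - dSeries (2 * k + 5) * h1 +
        dSeries_odd_quadratic k - dSeries (2 * k + 1) * h3
  · have h1 := two_mul_dSeries_even k
    have h2 := two_mul_dSeries_even (k + 1)
    rw [show 2 * (k + 1) + 1 = 2 * k + 3 by ring, show 2 * (k + 1) + 3 = 2 * k + 5 by ring,
      show 2 * (k + 1) + 2 = 2 * k + 4 by ring] at h2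
    have h3 := dSeries_odd_recurrence k
    rw [show 2 * k + 1 + 1 = 2 * k + 2 by ring, show 2 * k + 1 + 2 = 2 * k + 3 by ring,
      show 2 * k + 1 + 3 = 2 * k + 4 by ring]
    linear_combination dSeries (2 * k + 3) * h1 - dSeries (2 * k + 1) * h2 +
        dSeries_odd_quadratic k - dSeries (2 * k + 1) * h3

/-! ### Closed forms for a_m and b_m -/

theorem dSeries_ne_zero (m : ℕ) : dSeries m ≠ 0 := fun h => by
  simpa [h] using constantCoeff_dSeries m

theorem aSeries_mul_and_bSeries_mul (m : ℕ) :
    aSeries m * dSeries m = dSeries m - dSeries (m + 2) ∧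
      bSeries m * (dSeries m * dSeries (m + 1)) = PowerSeries.X := by
  induction m with
  | zero =>
    have h := two_mul_dSeries_even 0
    simp only [mul_zero, zero_add, dSeries_one, dSeries_three] at h
    refine ⟨mul_left_cancel₀ two_ne_zero_powerSeries ?_, ?_⟩
    · rw [aSeries_zero, dSeries_zero, zero_add]
      linear_combination h
    · rw [bSeries_zero, dSeries_zero, zero_add, dSeries_one, one_mul, mul_one]
  | succ m ih =>
    refine ⟨mul_left_cancel₀ (dSeries_ne_zero m) ?_, mul_left_cancel₀ (dSeries_ne_zero m) ?_⟩
    · rw [aSeries_succ, show m + 1 + 2 = m + 3 by ring]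
      linear_combination dSeries (m + 1) * ih.1 + ih.2 - dSeries_quadratic m
    · rw [show m + 1 + 1 = m + 2 by ring]
      linear_combination dSeries m * ih.2 +
        dSeries m * dSeries m * dSeries (m + 1) * bSeries_succ_mul m +
        bSeries (m + 1) * dSeries m * dSeries (m + 1) * ih.1

theorem mainTheorem7 :
    -- every denominator below has constant term `1`, so all inverses are genuine
    (∀ m : ℕ, PowerSeries.constantCoeff (1 - aSeries m - bSeries m) = 1 ∧
      PowerSeries.constantCoeff (dSeries m) = 1) ∧
    (∀ (u : Word 2) (m : ℕ),
      zetaPowLengthSeries 2 m u =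
        aSeries m ^ u.mult letterOne * bSeries m ^ u.mult letterTwo *
          ∏ i ∈ Finset.range m, (1 - aSeries i - bSeries i)⁻¹) ∧
    (∀ m : ℕ,
      aSeries m = PowerSeries.X * aBar m * (dSeries m)⁻¹ ∧
      bSeries m = PowerSeries.X * (dSeries m * dSeries (m + 1))⁻¹) := by
  refine ⟨fun m => ⟨constantCoeff_one_sub_aSeries_sub_bSeries m, constantCoeff_dSeries m⟩,
    zetaPowLengthSeries_eq, fun m => ?_⟩
  obtain ⟨ha, hb⟩ := aSeries_mul_and_bSeries_mul m
  refine ⟨(PowerSeries.eq_mul_inv_iff_mul_eq ?_).2 ?_, (PowerSeries.eq_mul_inv_iff_mul_eq ?_).2 hb⟩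
  · rw [constantCoeff_dSeries]
    exact one_ne_zero
  · rw [X_mul_aBar, ha]
  · rw [map_mul, constantCoeff_dSeries, constantCoeff_dSeries, one_mul]
    exact one_ne_zero
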